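/- Let $A$ be either the algebra $\mathbb{H}$ of quaternions or the algebra $\mathbb{O}$ of octonions, with conjugation $x\mapsto x^c$ and Euclidean topology, and let $\mathbb{S}_A=\{I\in A: I^2=-1\}$. For a set $D\subset\mathbb{C}$ put $\Omega_D=\{\alpha+\beta I:\alpha+\iota\beta\in D,\ I\in\mathbb{S}_A\}$; sets of this form are called circular. Endow $A\otimes_{\mathbb R}\mathbb{C}=A\oplus\iota A$ with the product $(x+\iota y)(x'+\iota y')=xx'-yy'+\iota(xy'+yx')$. *Slice functions.* Let $D=\overline D$ and $\Omega=\Omega_D$. A stem function $F=F_1+\iota F_2:D\to A\otimes_{\mathbb R}\mathbb{C}$ is a function with $F_1(\bar z)=F_1(z)$ and $F_2(\bar z)=-F_2(z)$ on $D$. It induces the slice function $f=\mathcal{I}(F):\Omega\to A$, $f(\alpha+\beta I)=F_1(\alpha+\iota\beta)+I\,F_2(\alpha+\iota\beta)$. For $f=\mathcal I(F)$ and $g=\mathcal I(G)$ set $f\cdot g=\mathcal{I}(FG)$, $f^c=\mathcal I(F_1^c+\iota F_2^c)$, $N(f)=f\cdot f^c$, and $f^{-\bullet}(x)=(N(f)(x))^{-1}f^c(x)$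 wherever $N(f)(x)\neq0$. *Slice-Nash functions.* Suppose moreover that $D$ is open and non-empty. The function $f=\mathcal I(F)$ is slice-Nash on $\Omega$, written $f\in\mathcal{SN}_A(\Omega)$, if $F$ is of class $C^1$ with $\partial F/\partial\alpha+\iota\,\partial F/\partial\beta=0$ on $D$ (so that $f$ is slice regular), and there are $I\in\mathbb S_A$ and a real basis of $A$ of the form $e_1=1,\ e_2=I,\ e_3=I_1,\ e_4=II_1,\ \ldots,\ e_{2u+1}=I_u,\ e_{2u+2}=II_u$ such that, writing $F=\sum_j F^j e_j$ with $F^j:D\to\mathbb C$, every $F^j$ is a complex Nash function. The last condition means that each point of $D$ has an open neighbourhood $U\subset D$ on which $F^j$ is holomorphic and $R(z,F^j(z))=0$ for some non-zero $R\in\mathbb{C}[z,t]$. A set $\Omega_0\subset A$ is a discrete set of singularities if it is closed and is a union of sets $\alpha+\beta\,\mathbb S_A$ with $\alpha,\beta\in\mathbb R$ (real points for $\beta=0$, spheres otherwise), each of them isolated in $\Omega_0$. A slice polynomial is a function $P(x)=\sum_{n=0}^m x^n\alpha_n$ on $A$ with coefficients $\alpha_n\in A$. **Theorem.** Let $\Omega_0\subset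 A$ be a discrete set of singularities and let $f\in\mathcal{SN}_A(A\setminus\Omega_0)$. Then there are slice polynomials $P$ and $Q$ such that $N(Q)$ has no zeros on $A\setminus\Omega_0$ and $$f(x)=(Q^{-\bullet}\cdot P)(x)\qquad\text{for all }x\in A\setminus\Omega_0 .$$ -/

import Mathlib

namespace SliceNash

noncomputable section

/-! ### The octonions -/

/-- The octonions `𝕆 = ℍ ⊕ ℓℍ`, with their Euclidean norm; `(α, β)` stands for `α + ℓβ`. -/
def Octonion : Type := WithLp 2 (Quaternion ℝ × Quaternion ℝ)

namespace Octonion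

instance : NormedAddCommGroup Octonion :=
  inferInstanceAs (NormedAddCommGroup (WithLp 2 (Quaternion ℝ × Quaternion ℝ)))

instance : NormedSpace ℝ Octonion :=
  inferInstanceAs (NormedSpace ℝ (WithLp 2 (Quaternion ℝ × Quaternion ℝ)))

/-- The octonion `α + ℓβ`. -/
def mk (α β : Quaternion ℝ) : Octonion := WithLp.toLp 2 (α, β)

/-- The component `α` of `α + ℓβ`. -/
def fst (x : Octonion) : Quaternion ℝ := WithLp.fst x

/-- The component `β` of `α + ℓβ`. -/
def snd (x : Octonion) : Quaternion ℝ := WithLp.snd x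

instance : One Octonion := ⟨mk 1 0⟩

/-- The Cayley-Dickson product `(α + ℓβ)(γ + ℓδ) = (αγ - δβᶜ) + ℓ(αᶜδ + γβ)`. -/
instance : Mul Octonion :=
  ⟨fun x y => mk (x.fst * y.fst - y.snd * star x.snd) (star x.fst * y.snd + y.fst * x.snd)⟩

/-- The conjugation `(α + ℓβ)ᶜ = αᶜ - ℓβ`. -/
instance : Star Octonion := ⟨fun x => mk (star x.fst) (-x.snd)⟩

/-- The inverse `x⁻¹ = n(x)⁻¹ xᶜ`, where `n(x) = x xᶜ = ‖x‖²`. -/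
instance : Inv Octonion := ⟨fun x => (‖x‖ ^ 2)⁻¹ • star x⟩

end Octonion

/-! ### Complexification and slices

The definitions below are used for `A = ℍ` and `A = 𝕆` only; they are written for any normed
space with the required operations so that they apply to both. -/

/-- The complexified algebra `A ⊗ ℂ`; `⟨x, y⟩` stands for `x + ιy`. -/
@[ext]
structure Complexification (A : Type*) where
  re : A
  im : A

/-- Complex Nash functions of one variable on `D`: near each point of `D`, `g` is analytic and
satisfies a nontrivial polynomial equation `P(z, g(z)) = 0`. -/
def IsComplexNash (D : Set ℂ) (g : ℂ → ℂ) : Prop :=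
  ∀ z₀ ∈ D, ∃ U : Set ℂ, IsOpen U ∧ z₀ ∈ U ∧ U ⊆ D ∧ AnalyticOnNhd ℂ g U ∧
    ∃ P : Polynomial (Polynomial ℂ), P ≠ 0 ∧ ∀ z ∈ U, P.evalEval z (g z) = 0

variable {A : Type*} [NormedAddCommGroup A] [NormedSpace ℝ A] [Mul A] [One A] [Star A] [Inv A]

namespace Complexification

/-- The product `(x + ιy)(x' + ιy') = (xx' - yy') + ι(xy' + yx')`. -/
instance : Mul (Complexification A) :=
  ⟨fun w w' => ⟨w.re * w'.re - w.im * w'.im, w.re * w'.im + w.im * w'.re⟩⟩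

/-- The complex conjugation `x + ιy ↦ x - ιy`. -/
def conj (w : Complexification A) : Complexification A := ⟨w.re, -w.im⟩

/-- The `*`-involution `(x + ιy)ᶜ = xᶜ + ιyᶜ`. -/
instance : Star (Complexification A) := ⟨fun w => ⟨star w.re, star w.im⟩⟩

/-- The map `A ⊗ ℂ → A`, `x + ιy ↦ x + I y`. -/
def toSlice (I : A) (w : Complexification A) : A := w.re + I * w.im

end Complexification

variable (A) in
/-- The sphere of imaginary units. -/
def unitSphere : Set A := {I | I * I = -1}

/-- The map `φ_I : ℂ → A`, `α + ιβ ↦ α + βI`. -/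
def slicePoint (I : A) (z : ℂ) : A := z.re • (1 : A) + z.im • I

/-- The circularised set `Ω_D` of `D ⊆ ℂ`. -/
def circularised (D : Set ℂ) : Set A := {x | ∃ z ∈ D, ∃ I ∈ unitSphere A, x = slicePoint I z}

/-- Circular subsets of `A`. -/
def IsCircular (Ω : Set A) : Prop := ∃ D : Set ℂ, Ω = circularised D

/-- For circular `Ω`, the unique conjugation-invariant `D ⊆ ℂ` whose circularised set is `Ω`. -/
def planarDomain (Ω : Set A) : Set ℂ := {z | ∃ I ∈ unitSphere A, slicePoint I z ∈ Ω}

/-- `Ω₀` is a discrete set of singularities in `A`: it is closed and is a union of sets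
`α + β𝕊_A` (real points when `β = 0`, spheres otherwise), each of them isolated in `Ω₀`. -/
def IsDiscreteSingularSet (Ω₀ : Set A) : Prop :=
  IsClosed Ω₀ ∧ ∃ Z : Set ℂ, Ω₀ = circularised Z ∧
    ∀ z ∈ Z, ∃ U : Set A, IsOpen U ∧ U ∩ Ω₀ = circularised {z}

/-! ### Slice functions

A function on `Ω ⊆ A` is a function `A → A` of which only the values on `Ω` are used, and
likewise for functions on `D ⊆ ℂ`. -/

/-- Stem functions on `D`. -/
def IsStem (D : Set ℂ) (F : ℂ → Complexification A) : Prop :=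
  ∀ z ∈ D, F (starRingEnd ℂ z) = (F z).conj

/-- `F` is a stem function on the planar domain of `Ω` and `f = 𝓘(F)` on `Ω`. -/
def IsInducedBy (Ω : Set A) (f : A → A) (F : ℂ → Complexification A) : Prop :=
  IsStem (planarDomain Ω) F ∧
    ∀ z ∈ planarDomain Ω, ∀ I ∈ unitSphere A, f (slicePoint I z) = (F z).toSlice I

/-- Holomorphic stem functions: `F₁, F₂` are of class `C¹` and
`∂F₁/∂α = ∂F₂/∂β`, `∂F₁/∂β = -∂F₂/∂α`. -/
def IsHolomorphicStem (D : Set ℂ) (F : ℂ → Complexification A) : Prop :=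
  IsStem D F ∧ ContDiffOn ℝ 1 (fun z => (F z).re) D ∧ ContDiffOn ℝ 1 (fun z => (F z).im) D ∧
    ∀ z ∈ D,
      fderiv ℝ (fun w => (F w).re) z 1 = fderiv ℝ (fun w => (F w).im) z Complex.I ∧
      fderiv ℝ (fun w => (F w).re) z Complex.I = -fderiv ℝ (fun w => (F w).im) z 1

/-- `b` is a splitting base `{1, I, I₁, II₁, …, I_u, II_u}` associated to `I`, where
`b (k, 0) = I_k` and `b (k, 1) = II_k`. -/
def IsSplittingBase {u : ℕ} (I : A) (b : Module.Basis (Fin (u + 1) × Fin 2) ℝ A) : Prop :=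
  I ∈ unitSphere A ∧ b (0, 0) = 1 ∧ ∀ k, b (k, 1) = I * b (k, 0)

/-- Stem-Nash functions: stem functions whose complex components with respect to some
splitting base are complex Nash functions. -/
def IsStemNash (D : Set ℂ) (F : ℂ → Complexification A) : Prop :=
  IsStem D F ∧ ∃ (u : ℕ) (I : A) (b : Module.Basis (Fin (u + 1) × Fin 2) ℝ A),
    IsSplittingBase I b ∧
      ∀ i, IsComplexNash D fun z => (⟨b.repr (F z).re i, b.repr (F z).im i⟩ : ℂ)

/-- `f ∈ 𝒮𝒩_A(Ω)`: `f` is a slice-Nash function on the open circular set `Ω`. -/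
def IsSliceNash (Ω : Set A) (f : A → A) : Prop :=
  Ω.Nonempty ∧ IsOpen Ω ∧ IsCircular Ω ∧ ∃ F : ℂ → Complexification A,
    IsInducedBy Ω f F ∧ IsHolomorphicStem (planarDomain Ω) F ∧ IsStemNash (planarDomain Ω) F

/-- `h` is the slice product `f · g = 𝓘(F G)` on `Ω`, where `f = 𝓘(F)` and `g = 𝓘(G)`. -/
def IsSliceProduct (Ω : Set A) (f g h : A → A) : Prop :=
  ∃ F G : ℂ → Complexification A,
    IsInducedBy Ω f F ∧ IsInducedBy Ω g G ∧ IsInducedBy Ω h fun z => F z * G z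

/-- On `Ω` the normal function `N(f) = 𝓘(F Fᶜ)` of `f = 𝓘(F)` has no zeros, and `r` is the slice
reciprocal `f^{-•}(x) = (N(f)(x))⁻¹ fᶜ(x)`, where `fᶜ = 𝓘(Fᶜ)`. -/
def IsSliceReciprocal (Ω : Set A) (f r : A → A) : Prop :=
  ∃ F : ℂ → Complexification A, IsInducedBy Ω f F ∧
    ∃ N c : A → A,
      IsInducedBy Ω N (fun z => F z * star (F z)) ∧ IsInducedBy Ω c (fun z => star (F z)) ∧
        ∀ x ∈ Ω, N x ≠ 0 ∧ r x = (N x)⁻¹ * c x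

/-! ### Slice polynomials -/

/-- Powers `xⁿ` in `A`. -/
def power (x : A) : ℕ → A
  | 0 => 1
  | n + 1 => x * power x n

/-- The polynomial function `x ↦ ∑ xⁿ αₙ` of the slice polynomial with coefficients `αₙ`,
finitely many of which are nonzero. -/
def polynomialFun (P : ℕ →₀ A) (x : A) : A := P.sum fun n a => power x n * a

end

end SliceNash

/-! In a splitting base `b` the stem function is `F = ∑ Gᵢ bᵢ` with every `Gᵢ` complex Nash on `D`,
the complement of a closed discrete subset of ℂ. Such a `Gᵢ` is rational. As `D` is connected, one
equation `P(z, Gᵢ z) = 0` holds on all of `D`. Cauchy's root bound then dominates `a Gᵢ`, with `a`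
the leading coefficient of `P`, by a continuous function of polynomial growth. So the singularities
of `a Gᵢ` are removable and, by Liouville, it is a polynomial (`IsComplexNash.exists_rational`).

A common denominator of least degree has no zeros on `D`. Multiplying it by its conjugate
polynomial, and using the symmetry of the `Gᵢ`, gives real polynomials with `q Gᵢ = pᵢ` and `q`
zero-free on `D` (`exists_real_denominator`). The quotient is then formed by `Q = q` and `P = ∑ pᵢ
bᵢ`. Since `q` is real, `Q` equals its conjugate, `N(Q) = q²`, and the reciprocal of `Q` is induced
by the scalar `1/q`. Scalars act on each coordinate separately, so associativity is never needed and
ℍ and 𝕆 are treated alike through `IsSliceAlgebra`. -/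

open Filter Topology Polynomial

namespace SliceNash

/-! ### Complements of closed discrete sets, and entire functions of polynomial growth. -/

section Entire

theorem countable_compl_of_mem_codiscrete {D : Set ℂ} (hD : D ∈ codiscrete ℂ) : Dᶜ.Countable :=
  (HereditarilyLindelofSpace.isLindelof _).countable_of_isDiscrete (mem_codiscrete'.1 hD).2

/-- Removing a countable set from a real vector space of dimension greater than 1 leaves a path
connected set. -/
theorem isPreconnected_of_mem_codiscrete {D : Set ℂ} (hD : D ∈ codiscrete ℂ) :
    IsPreconnected D := by
  have h := (countable_compl_of_mem_codiscrete hD).isPathConnected_compl_of_one_lt_rank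
    (by rw [Complex.rank_real_complex]; norm_num)
  rw [compl_compl] at h
  exact h.isConnected.isPreconnected

theorem dense_of_mem_codiscrete {D : Set ℂ} (hD : D ∈ codiscrete ℂ) : Dense D := by
  simpa using (countable_compl_of_mem_codiscrete hD).dense_compl ℝ

/-- An entire function of polynomial growth is a polynomial. -/
theorem exists_polynomial_of_growth {f : ℂ → ℂ} (hf : Differentiable ℂ f) {C : ℝ} {N : ℕ}
    (hC : ∀ z, ‖f z‖ ≤ C * (1 + ‖z‖) ^ N) : ∃ p : ℂ[X], ∀ z, f z = p.eval z := by
  have hC0 : 0 ≤ C := by simpa using (norm_nonneg _).trans (hC 0)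
  -- Cauchy's estimate on the circle of radius `R ≥ 1`, where `1 + ‖z‖ ≤ 2R`, bounds the derivative
  -- by a multiple of `R ^ (N - n) ≤ R⁻¹`; then `R → ∞`.
  have hder : ∀ n, N < n → iteratedDeriv n f 0 = 0 := by
    intro n hn
    have hbound : ∀ R : ℝ, 1 ≤ R →
        ‖iteratedDeriv n f 0‖ ≤ (n.factorial * (C * 2 ^ N)) * R⁻¹ := by
      intro R hR
      have hR0 : 0 < R := by linarith
      refine (Complex.norm_iteratedDeriv_le_of_forall_mem_sphere_norm_le (C := C * (2 * R) ^ N)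
        n hR0 hf.diffContOnCl ?_).trans ?_
      · intro z hz
        refine (hC z).trans ?_
        have : ‖z‖ = R := by simpa using hz
        rw [this]
        gcongr
        linarith
      · rw [div_eq_mul_inv, mul_pow]
        have h1 : R ^ N * (R ^ n)⁻¹ ≤ R⁻¹ := by
          rw [← div_eq_mul_inv, div_le_iff₀ (by positivity)]
          calc R ^ N ≤ R ^ (n - 1) := pow_le_pow_right₀ hR (by omega)
            _ = R⁻¹ * R ^ n := by
              obtain ⟨m, rfl⟩ : ∃ m, n = m + 1 := ⟨n - 1, by omega⟩
              rw [Nat.add_sub_cancel, pow_succ]; field_simp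
        calc _ = (n.factorial * (C * 2 ^ N)) * (R ^ N * (R ^ n)⁻¹) := by ring
          _ ≤ _ := by gcongr
    have hlim : Tendsto (fun R : ℝ => (n.factorial * (C * 2 ^ N)) * R⁻¹) atTop (𝓝 0) := by
      simpa using tendsto_inv_atTop_zero.const_mul ((n.factorial : ℝ) * (C * 2 ^ N))
    exact norm_le_zero_iff.1
      (ge_of_tendsto hlim ((eventually_ge_atTop 1).mono hbound))
  refine ⟨∑ n ∈ Finset.range (N + 1), Polynomial.monomial n
    ((n.factorial : ℂ)⁻¹ * iteratedDeriv n f 0), fun z => ?_⟩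
  rw [← Complex.taylorSeries_eq_of_entire' 0 z hf, tsum_eq_sum (s := Finset.range (N + 1))]
  · simp [eval_finsetSum]
  · intro n hn
    rw [hder n (by simpa using hn)]
    simp

/-- The constant does not depend on `M`, so polynomials of different degrees can be bounded with one
common exponent. -/
theorem exists_growth (p : ℂ[X]) :
    ∃ C : ℝ, 0 ≤ C ∧ ∀ M, p.natDegree ≤ M → ∀ z, ‖p.eval z‖ ≤ C * (1 + ‖z‖) ^ M := by
  refine ⟨∑ n ∈ Finset.range (p.natDegree + 1), ‖p.coeff n‖, by positivity, fun M hM z => ?_⟩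
  rw [eval_eq_sum_range, Finset.sum_mul]
  refine (norm_sum_le _ _).trans (Finset.sum_le_sum fun n hn => ?_)
  rw [norm_mul, norm_pow]
  gcongr
  calc ‖z‖ ^ n ≤ (1 + ‖z‖) ^ n := by gcongr; linarith
    _ ≤ (1 + ‖z‖) ^ M :=
      pow_le_pow_right₀ (by linarith [norm_nonneg z]) (by simp at hn; omega)

/-- Riemann's removable singularity theorem for a closed discrete set of singularities. -/
theorem exists_entire_extension {D : Set ℂ} (hD : D ∈ codiscrete ℂ) {f : ℂ → ℂ} {B : ℂ → ℝ}
    (hf : DifferentiableOn ℂ f D) (hB : Continuous B) (hfB : ∀ z ∈ D, ‖f z‖ ≤ B z) :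
    ∃ g : ℂ → ℂ, Differentiable ℂ g ∧ Set.EqOn f g D ∧ ∀ z, ‖g z‖ ≤ B z := by
  classical
  have hDo : IsOpen D := (mem_codiscrete'.1 hD).1
  let g : ℂ → ℂ := fun z => if z ∈ D then f z else limUnder (𝓝[≠] z) f
  have hfg : Set.EqOn f g D := fun z hz => by simp [g, hz]
  have hg : Differentiable ℂ g := by
    intro c
    by_cases hc : c ∈ D
    · have hn := hDo.mem_nhds hc
      exact ((hf c hc).differentiableAt hn).congr_of_eventuallyEq
        ((hfg.eventuallyEq_of_mem hn).symm)
    -- `D` contains a punctured neighbourhood of `c`; the compact ball makes the continuous bound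
    -- `B` a uniform one, as Riemann's theorem requires.
    · have hs : insert c D ∩ Metric.closedBall c 1 ∈ 𝓝 c := by
        refine inter_mem ?_ (Metric.closedBall_mem_nhds c one_pos)
        have := disjoint_principal_right.1 (mem_codiscrete.1 hD c)
        rw [compl_compl] at this
        rw [Set.insert_eq, Set.union_comm]
        have h2 := mem_nhdsWithin_iff_eventually.1 this
        filter_upwards [h2] with z hz
        by_cases hzc : z = c
        · right; exact hzc
        · left; exact hz hzc
      have hsub : (insert c D ∩ Metric.closedBall c 1) \ {c} ⊆ D := by
        rintro z ⟨⟨rfl | hz, -⟩, hzc⟩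
        · exact absurd rfl hzc
        · exact hz
      obtain ⟨M, hM⟩ := (isCompact_closedBall c 1).bddAbove_image hB.continuousOn
      have := Complex.differentiableOn_update_limUnder_of_bddAbove hs (hf.mono hsub) (by
        refine ⟨M, ?_⟩
        rintro _ ⟨z, hz, rfl⟩
        exact (hfB z (hsub hz)).trans (hM ⟨z, hz.1.2, rfl⟩))
      refine (this.differentiableAt hs).congr_of_eventuallyEq ?_
      filter_upwards [hs] with z hz
      by_cases hzc : z = c
      · subst hzc; simp [g, hc]
      · have : z ∈ D := hsub ⟨hz, hzc⟩
        simp [g, this, hzc]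
  refine ⟨g, hg, hfg, fun z => ?_⟩
  -- The bound is a closed condition and holds on the dense set `D`.
  have : IsClosed {z | ‖g z‖ ≤ B z} := isClosed_le hg.continuous.norm hB
  have h2 := this.closure_subset_iff.2 (fun z hz => by
    change ‖g z‖ ≤ B z
    rw [← hfg hz]; exact hfB z hz : D ⊆ {z | ‖g z‖ ≤ B z})
  rw [(dense_of_mem_codiscrete hD).closure_eq] at h2
  exact h2 (Set.mem_univ z)

end Entire

/-! ### Rationality of complex Nash functions and real common denominators. -/

section Rational

variable {D : Set ℂ} {g : ℂ → ℂ}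

theorem IsComplexNash.analyticOnNhd (hg : IsComplexNash D g) : AnalyticOnNhd ℂ g D := fun z hz => by
  obtain ⟨U, -, hzU, -, hU, -⟩ := hg z hz
  exact hU z hzU

/-- The equation valid near one point propagates over the connected set `D` by the identity theorem.
-/
theorem IsComplexNash.exists_evalEval_eq_zero (hD : D ∈ codiscrete ℂ) (hg : IsComplexNash D g) :
    ∃ P : ℂ[X][X], P ≠ 0 ∧ ∀ z ∈ D, P.evalEval z (g z) = 0 := by
  obtain ⟨z₀, hz₀⟩ := (dense_of_mem_codiscrete hD).nonempty
  obtain ⟨U, hUo, hzU, hUD, -, P, hP, hPU⟩ := hg z₀ hz₀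
  refine ⟨P, hP, ?_⟩
  have han : AnalyticOnNhd ℂ (fun z => P.evalEval z (g z)) D := by
    have : (fun z => P.evalEval z (g z)) =
        fun z => ∑ i ∈ Finset.range (P.natDegree + 1), (P.coeff i).eval z * (g z) ^ i := by
      funext z
      rw [evalEval, eval_eq_sum_range (p := P), eval_finsetSum]
      simp only [eval_mul, eval_pow, eval_C]
    rw [this]
    refine Finset.analyticOnNhd_fun_sum _ fun i _ => ?_
    exact AnalyticOnNhd.mul (fun z _ => (P.coeff i).differentiable.analyticAt z)
      (hg.analyticOnNhd.pow i)
  exact han.eqOn_zero_of_preconnected_of_eventuallyEq_zero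
    (isPreconnected_of_mem_codiscrete hD) hz₀ (Filter.mem_of_superset (hUo.mem_nhds hzU) hPU)

/-- Cauchy's bound for the root `w` of `P(z, ·)`, multiplied by the leading coefficient so that no
denominator remains. The resulting bound stays continuous at the zeros of that coefficient, where
the left side vanishes. -/
theorem norm_leadingCoeff_mul_le (P : ℂ[X][X]) {z w : ℂ} (h : P.evalEval z w = 0) :
    ‖P.leadingCoeff.eval z * w‖ ≤
      ∑ k ∈ Finset.range (P.natDegree + 1), ‖(P.coeff k).eval z‖ := by
  by_cases ha : P.leadingCoeff.eval z = 0
  · rw [ha, zero_mul, norm_zero]; positivity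
  set p := P.map (evalRingHom z) with hp
  have hdeg : p.natDegree = P.natDegree := natDegree_map_of_leadingCoeff_ne_zero _ ha
  have hlc : p.leadingCoeff = P.leadingCoeff.eval z := leadingCoeff_map_of_leadingCoeff_ne_zero _ ha
  have hp0 : p ≠ 0 := by
    intro h0; rw [h0, leadingCoeff_zero] at hlc; exact ha hlc.symm
  have hroot : p.IsRoot w := by rw [IsRoot.def, hp, map_evalRingHom_eval, h]
  have hb := (hroot.norm_lt_cauchyBound hp0).le
  rw [cauchyBound, hlc, hdeg, ← NNReal.coe_le_coe] at hb
  push_cast at hb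
  -- The top summand accounts for the `1` in Cauchy's bound; the other summands dominate the
  -- maximum.
  rw [norm_mul, Finset.sum_range_succ]
  have hapos : 0 < ‖P.leadingCoeff.eval z‖ := norm_pos_iff.2 ha
  have hsup : (((Finset.range P.natDegree).sup fun k => ‖p.coeff k‖₊ : NNReal) : ℝ) ≤
      ∑ k ∈ Finset.range P.natDegree, ‖(P.coeff k).eval z‖ := by
    have : ((Finset.range P.natDegree).sup fun k => ‖p.coeff k‖₊) ≤
        ∑ k ∈ Finset.range P.natDegree, ‖(P.coeff k).eval z‖₊ := by
      refine Finset.sup_le fun k hk => ?_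
      have : p.coeff k = (P.coeff k).eval z := by simp [hp]
      rw [this]
      exact Finset.single_le_sum (f := fun k => ‖(P.coeff k).eval z‖₊) (fun _ _ => zero_le) hk
    have h := NNReal.coe_le_coe.2 this
    push_cast at h
    exact h
  have h3 := mul_le_mul_of_nonneg_left hb hapos.le
  rw [mul_add, mul_one] at h3
  have h4 : ‖eval z P.leadingCoeff‖ * ((((Finset.range P.natDegree).sup fun k => ‖p.coeff k‖₊ :
      NNReal) : ℝ) / ‖eval z P.leadingCoeff‖) =
      (((Finset.range P.natDegree).sup fun k => ‖p.coeff k‖₊ : NNReal) : ℝ) := by field_simp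
  rw [h4] at h3
  exact h3.trans (add_le_add hsup le_rfl)

/-- A complex Nash function on the complement of a closed discrete set is rational. -/
theorem IsComplexNash.exists_rational (hD : D ∈ codiscrete ℂ) (hg : IsComplexNash D g) :
    ∃ q p : ℂ[X], q ≠ 0 ∧ ∀ z ∈ D, q.eval z * g z = p.eval z := by
  obtain ⟨P, hP, hPD⟩ := hg.exists_evalEval_eq_zero hD
  obtain ⟨G, hG, hGD, hGB⟩ := exists_entire_extension hD (f := fun z => P.leadingCoeff.eval z * g z)
    (B := fun z => ∑ k ∈ Finset.range (P.natDegree + 1), ‖(P.coeff k).eval z‖)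
    (P.leadingCoeff.differentiable.differentiableOn.mul hg.analyticOnNhd.differentiableOn)
    (continuous_finsetSum _ fun k _ => (P.coeff k).continuous.norm)
    (fun z hz => norm_leadingCoeff_mul_le P (hPD z hz))
  choose C hC0 hC using exists_growth
  obtain ⟨p, hp⟩ := exists_polynomial_of_growth hG
    (C := ∑ k ∈ Finset.range (P.natDegree + 1), C (P.coeff k))
    (N := ∑ k ∈ Finset.range (P.natDegree + 1), (P.coeff k).natDegree) (fun z => by
      refine (hGB z).trans ?_
      rw [Finset.sum_mul]
      refine Finset.sum_le_sum fun k hk => hC _ _ ?_ z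
      exact Finset.single_le_sum (f := fun k => (P.coeff k).natDegree) (fun _ _ => zero_le) hk)
  exact ⟨P.leadingCoeff, p, leadingCoeff_ne_zero.2 hP, fun z hz => (hGD hz).trans (hp z)⟩

variable {ι : Type*} [Fintype ι] {G : ι → ℂ → ℂ}

theorem exists_common_denominator (hD : D ∈ codiscrete ℂ) (hG : ∀ i, IsComplexNash D (G i)) :
    ∃ (q : ℂ[X]) (p : ι → ℂ[X]), q ≠ 0 ∧ ∀ i, ∀ z ∈ D, q.eval z * G i z = (p i).eval z := by
  classical
  choose q p hq hp using fun i => (hG i).exists_rational hD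
  refine ⟨∏ i, q i, fun i => (∏ j ∈ Finset.univ.erase i, q j) * p i,
    Finset.prod_ne_zero_iff.2 fun i _ => hq i, fun i z hz => ?_⟩
  rw [← Finset.prod_erase_mul _ _ (Finset.mem_univ i), eval_mul, eval_mul, ← hp i z hz, mul_assoc]

/-- A denominator of least degree works: at a zero `z₀ ∈ D` of `q` all `pᵢ = q Gᵢ` vanish too, so `X
- z₀` could be cancelled throughout. -/
theorem exists_zero_free_denominator (hD : D ∈ codiscrete ℂ) (hG : ∀ i, IsComplexNash D (G i)) :
    ∃ (q : ℂ[X]) (p : ι → ℂ[X]), (∀ z ∈ D, q.eval z ≠ 0) ∧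
      ∀ i, ∀ z ∈ D, q.eval z * G i z = (p i).eval z := by
  classical
  have hDo : IsOpen D := (mem_codiscrete'.1 hD).1
  have hex : ∃ n : ℕ, ∃ (q : ℂ[X]) (p : ι → ℂ[X]), q.natDegree = n ∧ q ≠ 0 ∧
      ∀ i, ∀ z ∈ D, q.eval z * G i z = (p i).eval z := by
    obtain ⟨q, p, hq⟩ := exists_common_denominator hD hG
    exact ⟨_, q, p, rfl, hq⟩
  obtain ⟨q, p, hn, hq, hp⟩ := Nat.find_spec hex
  refine ⟨q, p, fun z₀ hz₀ h0 => ?_, hp⟩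
  have hpz : ∀ i, (X - C z₀) ∣ p i := fun i => by
    rw [dvd_iff_isRoot, IsRoot.def, ← hp i z₀ hz₀, h0, zero_mul]
  choose p' hp' using hpz
  obtain ⟨q', rfl⟩ := dvd_iff_isRoot.2 h0
  have hq' : q' ≠ 0 := right_ne_zero_of_mul hq
  refine Nat.find_min hex (m := q'.natDegree) ?_ ⟨q', p', rfl, hq', fun i => ?_⟩
  · rw [← hn, natDegree_mul (X_sub_C_ne_zero z₀) hq', natDegree_X_sub_C]; omega
  · have hne : ∀ z ∈ D, z ≠ z₀ → q'.eval z * G i z = (p' i).eval z := fun z hz hzz => by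
      have := hp i z hz
      rw [hp', eval_mul, eval_mul, mul_assoc] at this
      exact mul_left_cancel₀ (by simpa [sub_eq_zero] using hzz) this
    intro z hz
    by_cases hzz : z = z₀
    -- At `z₀` itself the cancelled identity follows by continuity.
    · subst hzz
      have hc : ContinuousAt (fun w => q'.eval w * G i w) z :=
        q'.continuous.continuousAt.mul ((hG i).analyticOnNhd z hz).continuousAt
      refine tendsto_nhds_unique (hc.tendsto.mono_left nhdsWithin_le_nhds : Tendsto _ (𝓝[≠] z) _)
        (((p' i).continuous.tendsto z).mono_left nhdsWithin_le_nhds |>.congr' ?_)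
      filter_upwards [self_mem_nhdsWithin, mem_nhdsWithin_of_mem_nhds (hDo.mem_nhds hz)] with w h1 h2
      exact (hne w h2 h1).symm
    · exact hne z hz hzz

theorem eval_map_conj (p : ℂ[X]) (z : ℂ) :
    (p.map (starRingEnd ℂ)).eval z = starRingEnd ℂ (p.eval (starRingEnd ℂ z)) := by
  rw [← eval_map_apply, Complex.conj_conj]

theorem exists_real_polynomial (p : ℂ[X])
    (hp : ∀ z ∈ D, p.eval (starRingEnd ℂ z) = starRingEnd ℂ (p.eval z)) :
    ∃ r : ℝ[X], ∀ z ∈ D, aeval z r = p.eval z := by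
  refine ⟨∑ n ∈ Finset.range (p.natDegree + 1), monomial n (p.coeff n).re, fun z hz => ?_⟩
  -- On `D` the values of `p` agree with those of its average with the conjugate polynomial, whose
  -- coefficients are the real parts.
  have h1 : p.eval z = (p.eval z + (p.map (starRingEnd ℂ)).eval z) / 2 := by
    rw [eval_map_conj, hp z hz, Complex.conj_conj]; ring
  rw [h1, eval_eq_sum_range, eval_eq_sum_range' (n := p.natDegree + 1)
    (Nat.lt_succ_of_le natDegree_map_le), ← Finset.sum_add_distrib, Finset.sum_div, map_sum]
  refine Finset.sum_congr rfl fun n _ => ?_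
  rw [aeval_monomial, coeff_map, ← add_mul, Complex.add_conj]
  simp; ring

/-- With `q*` the conjugate polynomial of `q`, the product `q q*` is real and, as `D` is conjugation
invariant, zero-free on `D`. The numerators `pᵢ q* = (q q*) Gᵢ` inherit the symmetry of `Gᵢ`. -/
theorem exists_real_denominator (hD : D ∈ codiscrete ℂ) (hconj : ∀ z ∈ D, starRingEnd ℂ z ∈ D)
    (hG : ∀ i, IsComplexNash D (G i))
    (hsym : ∀ i, ∀ z ∈ D, G i (starRingEnd ℂ z) = starRingEnd ℂ (G i z)) :
    ∃ (q : ℝ[X]) (p : ι → ℝ[X]), (∀ z ∈ D, aeval z q ≠ 0) ∧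
      ∀ i, ∀ z ∈ D, aeval z q * G i z = aeval z (p i) := by
  obtain ⟨q, p, hq, hp⟩ := exists_zero_free_denominator hD hG
  obtain ⟨r, hr⟩ := exists_real_polynomial (D := D) (q * q.map (starRingEnd ℂ)) (fun z _ => by
    simp [eval_map_conj, mul_comm])
  have hG' : ∀ i, ∀ z ∈ D,
      aeval z r * G i z = (p i * q.map (starRingEnd ℂ)).eval z := fun i z hz => by
    rw [hr z hz, eval_mul, eval_mul, ← hp i z hz]; ring
  choose s hs using fun i => exists_real_polynomial (D := D) (p i * q.map (starRingEnd ℂ))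
    (fun z hz => by
      have hc : aeval (starRingEnd ℂ z) r = starRingEnd ℂ (aeval z r) := aeval_conj r z
      rw [← hG' i _ (hconj z hz), ← hG' i z hz, hsym i z hz, hc, map_mul])
  refine ⟨r, s, fun z hz => ?_, fun i z hz => by rw [hG' i z hz, hs i z hz]⟩
  rw [hr z hz, eval_mul, eval_map_conj]
  exact mul_ne_zero (hq z hz) (by simpa using hq _ (hconj z hz))

end Rational

/-! ### Algebra and topology of slices. -/

section SliceAlgebra

/-- The properties of the real algebra `A`, possibly not associative, on which the theory of slice
polynomials and of circular sets rests. -/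
structure IsSliceAlgebra (A : Type*) [NormedAddCommGroup A] [NormedSpace ℝ A] [Mul A] [One A]
    [Star A] [Inv A] : Prop where
  mul_add : ∀ x y z : A, x * (y + z) = x * y + x * z
  add_mul : ∀ x y z : A, (x + y) * z = x * z + y * z
  smul_mul : ∀ (r : ℝ) (x y : A), (r • x) * y = r • (x * y)
  mul_smul : ∀ (r : ℝ) (x y : A), x * (r • y) = r • (x * y)
  one_mul : ∀ x : A, 1 * x = x
  mul_one : ∀ x : A, x * 1 = x
  star_smul_one : ∀ r : ℝ, star (r • (1 : A)) = r • (1 : A)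
  exists_slicePoint : ∀ x : A, ∃ I ∈ unitSphere A, ∃ z, x = slicePoint I z
  eq_or_eq_conj : ∀ I ∈ unitSphere A, ∀ J ∈ unitSphere A, ∀ z w : ℂ,
    slicePoint I z = slicePoint J w → z = w ∨ z = starRingEnd ℂ w
  inv_slicePoint : ∀ I ∈ unitSphere A, ∀ z : ℂ, (slicePoint I z)⁻¹ = slicePoint I z⁻¹

section

variable {A : Type*} [NormedAddCommGroup A] [NormedSpace ℝ A] [One A]

theorem slicePoint_add (I : A) (z w : ℂ) :
    slicePoint I (z + w) = slicePoint I z + slicePoint I w := by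
  simp only [slicePoint, Complex.add_re, Complex.add_im, add_smul]; abel

theorem slicePoint_zero (I : A) : slicePoint I 0 = 0 := by simp [slicePoint]

theorem slicePoint_one (I : A) : slicePoint I 1 = 1 := by simp [slicePoint]

theorem slicePoint_real_mul (I : A) (r : ℝ) (z : ℂ) :
    slicePoint I (r * z) = r • slicePoint I z := by
  simp [slicePoint, smul_add, mul_smul]

theorem continuous_slicePoint (I : A) : Continuous (slicePoint I) := by
  unfold slicePoint
  fun_prop

theorem slicePoint_neg_conj (I : A) (z : ℂ) :
    slicePoint (-I) (starRingEnd ℂ z) = slicePoint I z := by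
  simp [slicePoint]

end

variable {A : Type*} [NormedAddCommGroup A] [NormedSpace ℝ A] [Mul A] [One A] [Star A] [Inv A]

namespace IsSliceAlgebra

variable (hA : IsSliceAlgebra A)
include hA

theorem mul_zero (x : A) : x * 0 = 0 := by simpa using hA.mul_smul 0 x 0

theorem neg_mul (x y : A) : -x * y = -(x * y) := by simpa using hA.smul_mul (-1) x y

theorem mul_neg (x y : A) : x * -y = -(x * y) := by simpa using hA.mul_smul (-1) x y

theorem mul_sum {ι : Type*} (s : Finset ι) (x : A) (f : ι → A) :
    x * ∑ i ∈ s, f i = ∑ i ∈ s, x * f i :=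
  map_sum (⟨⟨fun y => x * y, hA.mul_zero x⟩, hA.mul_add x⟩ : A →+ A) f s

theorem neg_mem_unitSphere {I : A} (hI : I ∈ unitSphere A) : -I ∈ unitSphere A := by
  change -I * -I = -1
  rw [hA.neg_mul, hA.mul_neg, neg_neg]; exact hI

theorem slicePoint_mul {I : A} (hI : I ∈ unitSphere A) (z w : ℂ) :
    slicePoint I (z * w) = slicePoint I z * slicePoint I w := by
  have hI' : I * I = -1 := hI
  simp only [slicePoint, hA.add_mul, hA.mul_add, hA.smul_mul, hA.mul_smul, hA.one_mul, hA.mul_one,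
    hI', Complex.mul_re, Complex.mul_im]
  module

theorem slicePoint_mul_apply (I : A) (z : ℂ) (a : A) :
    slicePoint I z * a = z.re • a + z.im • (I * a) := by
  simp only [slicePoint, hA.add_mul, hA.smul_mul, hA.one_mul]

theorem slicePoint_eq_zero {I : A} (hI : I ∈ unitSphere A) {z : ℂ} (h : slicePoint I z = 0) :
    z = 0 := by
  rw [← slicePoint_zero I] at h
  simpa using hA.eq_or_eq_conj I hI I hI z 0 h

/-! ### Planar domains -/

theorem mem_circularised {Z : Set ℂ} {I : A} (hI : I ∈ unitSphere A) {z : ℂ} :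
    slicePoint I z ∈ circularised (A := A) Z ↔ z ∈ Z ∨ starRingEnd ℂ z ∈ Z := by
  constructor
  · rintro ⟨w, hw, J, hJ, h⟩
    rcases hA.eq_or_eq_conj I hI J hJ z w h with rfl | rfl
    · exact Or.inl hw
    · right; simpa using hw
  · rintro (h | h)
    · exact ⟨z, h, I, hI, rfl⟩
    · exact ⟨_, h, -I, hA.neg_mem_unitSphere hI, (slicePoint_neg_conj I z).symm⟩

theorem conj_mem_planarDomain {Ω : Set A} {z : ℂ} (hz : z ∈ planarDomain Ω) :
    starRingEnd ℂ z ∈ planarDomain Ω := by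
  obtain ⟨I, hI, h⟩ := hz
  exact ⟨-I, hA.neg_mem_unitSphere hI, by rwa [slicePoint_neg_conj]⟩

/-- In the plane of one fixed unit `I`, an isolated sphere of `Ω₀` is seen as at most two conjugate
points. -/
theorem planarDomain_mem_codiscrete {Ω₀ : Set A} (h : IsDiscreteSingularSet Ω₀) :
    planarDomain Ω₀ᶜ ∈ codiscrete ℂ := by
  obtain ⟨hcl, Z, rfl, hZ⟩ := h
  have hI₀ : ∃ I : A, I ∈ unitSphere A := by
    obtain ⟨I, hI, -⟩ := hA.exists_slicePoint 0
    exact ⟨I, hI⟩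
  obtain ⟨I, hI⟩ := hI₀
  have hmem : ∀ w, w ∉ planarDomain (circularised (A := A) Z)ᶜ →
      slicePoint I w ∈ circularised (A := A) Z := fun w hw => by
    by_contra hcon
    exact hw ⟨I, hI, hcon⟩
  rw [mem_codiscrete]
  intro z
  rw [disjoint_principal_right, compl_compl]
  by_cases hz : slicePoint I z ∈ circularised (A := A) Z
  · have hz' : ∃ z' ∈ Z, slicePoint I z ∈ circularised (A := A) {z'} := by
      rcases (hA.mem_circularised hI).1 hz with h | h
      · exact ⟨z, h, (hA.mem_circularised hI).2 (Or.inl rfl)⟩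
      · exact ⟨_, h, (hA.mem_circularised hI).2 (Or.inr rfl)⟩
    obtain ⟨z', hz'Z, hz'⟩ := hz'
    obtain ⟨U, hU, hUZ⟩ := hZ z' hz'Z
    have hzU : slicePoint I z ∈ U := (hUZ.symm.subset hz').1
    have hn : slicePoint I ⁻¹' U ∈ 𝓝 z :=
      (continuous_slicePoint I).continuousAt.preimage_mem_nhds (hU.mem_nhds hzU)
    -- This neighbourhood avoids the conjugate partner of `z`, which lies on the same sphere.
    have hfin : ({z', starRingEnd ℂ z'} \ {z} : Set ℂ)ᶜ ∈ 𝓝 z :=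
      (((Set.toFinite _).subset Set.sdiff_subset).isClosed.isOpen_compl).mem_nhds (by simp)
    filter_upwards [self_mem_nhdsWithin, mem_nhdsWithin_of_mem_nhds hn,
      mem_nhdsWithin_of_mem_nhds hfin] with w hw hwU hwf
    by_contra hcon
    have := (hA.mem_circularised hI).1 (hUZ.subset ⟨hwU, hmem w hcon⟩)
    refine hwf ⟨?_, hw⟩
    rcases this with h | h
    · left; exact h
    · right
      have h' : starRingEnd ℂ w = z' := h
      simp [← h']
  · refine mem_nhdsWithin_of_mem_nhds (Filter.mem_of_superset
      ((continuous_slicePoint I).continuousAt.preimage_mem_nhds (hcl.isOpen_compl.mem_nhds hz)) ?_)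
    exact fun w hw => ⟨I, hI, hw⟩

end IsSliceAlgebra

/-! ### Stem functions with scalar and vector values -/

namespace Complexification

/-- The element `s ⊗ 1` of `A ⊗ ℂ`. -/
noncomputable def scalar (s : ℂ) : Complexification A := ⟨s.re • 1, s.im • 1⟩

/-- The element `∑ i, bᵢ ⊗ gᵢ` of `A ⊗ ℂ`. -/
noncomputable def combination {ι : Type*} [Fintype ι] (b : ι → A) (g : ι → ℂ) :
    Complexification A :=
  ⟨∑ i, (g i).re • b i, ∑ i, (g i).im • b i⟩

theorem conj_scalar {A : Type*} [NormedAddCommGroup A] [NormedSpace ℝ A] [One A] (s : ℂ) :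
    (scalar s : Complexification A).conj = scalar (starRingEnd ℂ s) := by
  simp [scalar, conj]

theorem conj_combination {A ι : Type*} [NormedAddCommGroup A] [NormedSpace ℝ A] [Fintype ι]
    (b : ι → A) (g : ι → ℂ) :
    (combination b g).conj = combination b fun i => starRingEnd ℂ (g i) := by
  simp [combination, conj]

end Complexification

open Complexification

namespace IsSliceAlgebra

variable (hA : IsSliceAlgebra A)
include hA

theorem star_scalar (s : ℂ) : star (scalar s : Complexification A) = scalar s := by
  change (⟨star _, star _⟩ : Complexification A) = _
  simp only [scalar, hA.star_smul_one]

theorem scalar_mul_scalar (s t : ℂ) :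
    (scalar s * scalar t : Complexification A) = scalar (s * t) := by
  change (⟨_ - _, _ + _⟩ : Complexification A) = _
  simp only [scalar, hA.smul_mul, hA.one_mul, Complex.mul_re, Complex.mul_im, Complexification.mk.injEq]
  constructor <;> module

theorem scalar_mul_combination {ι : Type*} [Fintype ι] (s : ℂ) (b : ι → A) (g : ι → ℂ) :
    scalar s * combination b g = combination b fun i => s * g i := by
  change (⟨_ - _, _ + _⟩ : Complexification A) = _
  simp only [scalar, combination, hA.smul_mul, hA.one_mul, Complex.mul_re, Complex.mul_im,
    Complexification.mk.injEq, Finset.smul_sum, ← Finset.sum_sub_distrib, ← Finset.sum_add_distrib]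
  constructor <;> exact Finset.sum_congr rfl fun i _ => by module

theorem toSlice_scalar (I : A) (s : ℂ) : (scalar s).toSlice I = slicePoint I s := by
  simp only [toSlice, scalar, slicePoint, hA.mul_smul, hA.mul_one]

theorem toSlice_combination {ι : Type*} [Fintype ι] (I : A) (b : ι → A) (g : ι → ℂ) :
    (combination b g).toSlice I = ∑ i, slicePoint I (g i) * b i := by
  simp only [toSlice, combination, hA.slicePoint_mul_apply, hA.mul_sum, hA.mul_smul,
    Finset.sum_add_distrib]

end IsSliceAlgebra

/-! ### Slice polynomials with coefficients in the span of given vectors -/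

/-- The slice polynomial `∑ xⁿ (qₙ a)` for a real polynomial `q`. -/
noncomputable def ofRealPolynomial (q : ℝ[X]) (a : A) : ℕ →₀ A :=
  q.sum fun n r => Finsupp.single n (r • a)

namespace IsSliceAlgebra

variable (hA : IsSliceAlgebra A)
include hA

theorem power_slicePoint {I : A} (hI : I ∈ unitSphere A) (z : ℂ) (n : ℕ) :
    power (slicePoint I z) n = slicePoint I (z ^ n) := by
  induction n with
  | zero => simp [power, slicePoint_one]
  | succ n ih => rw [power, ih, pow_succ', hA.slicePoint_mul hI]

theorem polynomialFun_sum {ι : Type*} (s : Finset ι) (P : ι → ℕ →₀ A) (x : A) :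
    polynomialFun (∑ i ∈ s, P i) x = ∑ i ∈ s, polynomialFun (P i) x :=
  map_sum (⟨⟨fun P => polynomialFun P x, Finsupp.sum_zero_index⟩, fun _ _ =>
    Finsupp.sum_add_index' (fun _ => hA.mul_zero _) fun _ _ _ => hA.mul_add _ _ _⟩ :
      (ℕ →₀ A) →+ A) P s

/-- Real coefficients pass through every product, and powers of `slicePoint I z` are computed in the
plane of `I`, a copy of ℂ; only one product with `a` remains. -/
theorem polynomialFun_ofRealPolynomial {I : A} (hI : I ∈ unitSphere A) (q : ℝ[X]) (a : A) (z : ℂ) :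
    polynomialFun (ofRealPolynomial q a) (slicePoint I z) = slicePoint I (aeval z q) * a := by
  let φ : ℂ →+ A := ⟨⟨fun w => slicePoint I w * a, by simp [hA.slicePoint_mul_apply]⟩, fun v w => by
    simp only [slicePoint_add, hA.add_mul]⟩
  change _ = φ _
  rw [ofRealPolynomial, Polynomial.sum, hA.polynomialFun_sum, aeval_def, eval₂_eq_sum,
    Polynomial.sum, map_sum]
  refine Finset.sum_congr rfl fun n _ => ?_
  change _ = slicePoint I ((q.coeff n : ℂ) * z ^ n) * a
  rw [slicePoint_real_mul, hA.smul_mul, polynomialFun,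
    Finsupp.sum_single_index (h := fun n a => power (slicePoint I z) n * a) (hA.mul_zero _),
    hA.power_slicePoint hI, hA.mul_smul]

/-! ### Slice-Nash functions are slice rational -/

theorem isInducedBy_scalar {Ω : Set A} {f : A → A} {s : ℂ → ℂ}
    (hs : ∀ z, s (starRingEnd ℂ z) = starRingEnd ℂ (s z))
    (hf : ∀ I ∈ unitSphere A, ∀ z ∈ planarDomain Ω, f (slicePoint I z) = slicePoint I (s z)) :
    IsInducedBy Ω f fun z => scalar (s z) :=
  ⟨fun z _ => by simp only [conj_scalar, hs], fun z hz I hI => by rw [hA.toSlice_scalar, hf I hI z hz]⟩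

theorem isInducedBy_ofRealPolynomial (Ω : Set A) (q : ℝ[X]) :
    IsInducedBy Ω (polynomialFun (ofRealPolynomial q (1 : A))) fun z => scalar (aeval z q) :=
  hA.isInducedBy_scalar (fun z => aeval_conj q z) fun I hI z _ => by
    rw [hA.polynomialFun_ofRealPolynomial hI, hA.mul_one]

theorem isInducedBy_sum_ofRealPolynomial (Ω : Set A) {ι : Type*} [Fintype ι] (p : ι → ℝ[X])
    (b : ι → A) :
    IsInducedBy Ω (polynomialFun (∑ i, ofRealPolynomial (p i) (b i)))
      fun z => combination b fun i => aeval z (p i) := by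
  refine ⟨fun z _ => ?_, fun z _ I hI => ?_⟩
  · rw [conj_combination]
    exact congrArg (combination b) (_root_.funext fun i => aeval_conj (p i) z)
  · rw [hA.polynomialFun_sum, hA.toSlice_combination]
    exact Finset.sum_congr rfl fun i _ => hA.polynomialFun_ofRealPolynomial hI _ _ _

/-- A slice-Nash function off a discrete set of singularities is a quotient of slice polynomials. -/
theorem exists_quotient_of_isSliceNash {Ω₀ : Set A} {f : A → A} (hΩ₀ : IsDiscreteSingularSet Ω₀)
    (hf : IsSliceNash Ω₀ᶜ f) :
    ∃ (P Q : ℕ →₀ A) (r : A → A), IsSliceReciprocal Ω₀ᶜ (polynomialFun Q) r ∧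
      IsSliceProduct Ω₀ᶜ r (polynomialFun P) f := by
  obtain ⟨-, -, -, F, hF, -, hstem, u, -, b, -, hN⟩ := hf
  have hD := hA.planarDomain_mem_codiscrete hΩ₀
  obtain ⟨q, p, hq, hp⟩ := exists_real_denominator hD (fun z hz => hA.conj_mem_planarDomain hz) hN
    (fun i z hz => by
      rw [hstem z hz]
      apply Complex.ext <;> simp [Complexification.conj])
  have hFb : ∀ z, F z = combination b fun i => ⟨b.repr (F z).re i, b.repr (F z).im i⟩ := fun z =>
    Complexification.ext (b.sum_repr _).symm (b.sum_repr _).symm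
  have hQ := hA.isInducedBy_ofRealPolynomial Ω₀ᶜ q
  have hQ2 := hA.isInducedBy_ofRealPolynomial Ω₀ᶜ (q * q)
  -- This is `N(Q)⁻¹ Qᶜ` with `N(Q) = q²` and `Qᶜ = Q = q`; on slices it equals `1/q`.
  set r : A → A := fun x => (polynomialFun (ofRealPolynomial (q * q) 1) x)⁻¹ *
    polynomialFun (ofRealPolynomial q 1) x with hr
  refine ⟨∑ i, ofRealPolynomial (p i) (b i), ofRealPolynomial q 1, r,
    ⟨_, hQ, polynomialFun (ofRealPolynomial (q * q) 1), polynomialFun (ofRealPolynomial q 1),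
      ?_, ?_, fun x hx => ⟨?_, rfl⟩⟩, fun z => scalar (aeval z q)⁻¹, _, ?_,
      hA.isInducedBy_sum_ofRealPolynomial Ω₀ᶜ p b, ?_⟩
  · simpa only [hA.star_scalar, hA.scalar_mul_scalar, map_mul] using hQ2
  · simpa only [hA.star_scalar] using hQ
  · obtain ⟨I, hI, z, rfl⟩ := hA.exists_slicePoint x
    have hz : z ∈ planarDomain Ω₀ᶜ := ⟨I, hI, hx⟩
    rw [hA.polynomialFun_ofRealPolynomial hI, hA.mul_one, map_mul]
    exact fun h => mul_self_ne_zero.2 (hq z hz) (hA.slicePoint_eq_zero hI h)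
  · refine hA.isInducedBy_scalar (fun z => ?_) fun I hI z hz => ?_
    · rw [map_inv₀]
      exact congrArg _ (aeval_conj q z)
    · rw [hr]
      simp only
      rw [hA.polynomialFun_ofRealPolynomial hI, hA.polynomialFun_ofRealPolynomial hI, hA.mul_one,
        hA.mul_one, hA.inv_slicePoint I hI, ← hA.slicePoint_mul hI, map_mul]
      have := hq z hz
      congr 1
      field_simp
  · have hFz : ∀ z ∈ planarDomain Ω₀ᶜ,
        scalar (aeval z q)⁻¹ * combination b (fun i => aeval z (p i)) = F z := fun z hz => by
      rw [hA.scalar_mul_combination, hFb z]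
      congr 1
      funext i
      rw [← hp i z hz, inv_mul_cancel_left₀ (hq z hz)]
    refine ⟨fun z hz => ?_, fun z hz I hI => ?_⟩
    · beta_reduce
      rw [hFz z hz, hFz _ (hA.conj_mem_planarDomain hz), hF.1 z hz]
    · beta_reduce
      rw [hFz z hz, hF.2 z hz I hI]

end IsSliceAlgebra

end SliceAlgebra

/-- A criterion for `IsSliceAlgebra` in terms of the real part `ρ` and the norm. -/
theorem isSliceAlgebra_of_realPart {A : Type*} [NormedAddCommGroup A] [NormedSpace ℝ A] [Mul A]
    [One A] [Star A] [Inv A] (mul_add : ∀ x y z : A, x * (y + z) = x * y + x * z)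
    (add_mul : ∀ x y z : A, (x + y) * z = x * z + y * z)
    (smul_mul : ∀ (r : ℝ) (x y : A), (r • x) * y = r • (x * y))
    (mul_smul : ∀ (r : ℝ) (x y : A), x * (r • y) = r • (x * y))
    (one_mul : ∀ x : A, 1 * x = x) (mul_one : ∀ x : A, x * 1 = x)
    (ρ : A →ₗ[ℝ] ℝ) (ρ_one : ρ 1 = 1)
    (star_eq : ∀ x, star x = (2 * ρ x) • (1 : A) - x)
    (inv_eq : ∀ x : A, x⁻¹ = (‖x‖ ^ 2)⁻¹ • star x)
    (norm_sq : ∀ (r : ℝ) (y : A), ρ y = 0 → ‖r • 1 + y‖ ^ 2 = r ^ 2 + ‖y‖ ^ 2)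
    (mem_unitSphere : ∀ I : A, I ∈ unitSphere A ↔ ρ I = 0 ∧ ‖I‖ = 1)
    (unitSphere_nonempty : (unitSphere A).Nonempty) : IsSliceAlgebra A := by
  have hρ : ∀ I ∈ unitSphere A, ∀ z, ρ (slicePoint I z) = z.re := fun I hI z => by
    simp [slicePoint, ρ_one, ((mem_unitSphere I).1 hI).1]
  have hnorm : ∀ I ∈ unitSphere A, ∀ z, ‖slicePoint I z‖ ^ 2 = Complex.normSq z := fun I hI z => by
    rw [slicePoint, norm_sq _ _ (by simp [((mem_unitSphere I).1 hI).1]), norm_smul,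
      ((mem_unitSphere I).1 hI).2, Complex.normSq_apply]
    simp; ring
  refine ⟨mul_add, add_mul, smul_mul, mul_smul, one_mul, mul_one, fun r => ?_, fun x => ?_,
    fun I hI J hJ z w h => ?_, fun I hI z => ?_⟩
  · rw [star_eq, map_smul, ρ_one, smul_eq_mul]; module
  · by_cases hy : x - ρ x • (1 : A) = 0
    · obtain ⟨I, hI⟩ := unitSphere_nonempty
      exact ⟨I, hI, ρ x, by simpa [slicePoint] using sub_eq_zero.1 hy⟩
    -- The unit is the normalised imaginary part of `x`; for real `x`, any unit serves.
    · have hy' : ‖x - ρ x • (1 : A)‖ ≠ 0 := norm_ne_zero_iff.2 hy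
      refine ⟨‖x - ρ x • (1 : A)‖⁻¹ • (x - ρ x • (1 : A)), (mem_unitSphere _).2 ⟨?_, ?_⟩,
        ⟨ρ x, ‖x - ρ x • (1 : A)‖⟩, ?_⟩
      · simp [ρ_one]
      · rw [norm_smul, norm_inv, norm_norm, inv_mul_cancel₀ hy']
      · simp only [slicePoint]
        rw [smul_inv_smul₀ hy']; abel
  -- Real part and norm of the point determine `z` up to conjugation.
  · have hre : z.re = w.re := by rw [← hρ I hI z, h, hρ J hJ w]
    have hsq : Complex.normSq z = Complex.normSq w := by rw [← hnorm I hI z, h, hnorm J hJ w]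
    rw [Complex.normSq_apply, Complex.normSq_apply, hre, add_right_inj] at hsq
    rcases mul_self_eq_mul_self_iff.1 hsq with him | him
    · exact Or.inl (Complex.ext hre him)
    · exact Or.inr (Complex.ext hre him)
  · rw [inv_eq, hnorm I hI, star_eq, hρ I hI]
    simp only [slicePoint, Complex.inv_re, Complex.inv_im, div_eq_inv_mul]
    module

/-! ### The quaternions. -/

theorem quaternion_mem_unitSphere (I : Quaternion ℝ) :
    I ∈ unitSphere (Quaternion ℝ) ↔ I.re = 0 ∧ ‖I‖ = 1 := by
  have hn : ‖I‖ = 1 ↔ I.re ^ 2 + I.imI ^ 2 + I.imJ ^ 2 + I.imK ^ 2 = 1 := by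
    rw [← Quaternion.normSq_def', Quaternion.normSq_eq_norm_mul_self]
    constructor
    · intro h; rw [h]; norm_num
    · intro h; nlinarith [norm_nonneg I]
  rw [hn]
  change I * I = -1 ↔ _
  simp only [Quaternion.ext_iff, Quaternion.re_mul, Quaternion.imI_mul, Quaternion.imJ_mul,
    Quaternion.imK_mul, Quaternion.re_neg, Quaternion.imI_neg, Quaternion.imJ_neg,
    Quaternion.imK_neg, Quaternion.re_one, Quaternion.imI_one, Quaternion.imJ_one,
    Quaternion.imK_one, neg_zero]
  constructor
  · rintro ⟨h0, h1, h2, h3⟩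
    -- The imaginary components of `I * I` are `2 I.re` times those of `I`; were `I.re` nonzero, `I`
    -- would be real with square `-1`.
    have hre : I.re = 0 := by
      by_contra hne
      have e1 : I.imI = 0 := (mul_eq_zero.1 (by linarith : I.re * I.imI = 0)).resolve_left hne
      have e2 : I.imJ = 0 := (mul_eq_zero.1 (by linarith : I.re * I.imJ = 0)).resolve_left hne
      have e3 : I.imK = 0 := (mul_eq_zero.1 (by linarith : I.re * I.imK = 0)).resolve_left hne
      rw [e1, e2, e3] at h0
      nlinarith [sq_nonneg I.re]
    refine ⟨hre, ?_⟩
    rw [hre] at h0 ⊢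
    linarith
  · rintro ⟨h0, h1⟩
    rw [h0] at h1 ⊢
    refine ⟨by linarith, by ring, by ring, by ring⟩

theorem quaternion_star_eq (x : Quaternion ℝ) : star x = (2 * x.re) • (1 : Quaternion ℝ) - x := by
  ext <;> simp [Quaternion.re_one, Quaternion.imI_one, Quaternion.imJ_one,
    Quaternion.imK_one]
  ring

theorem exists_quaternion_imaginary_unit : ∃ i : Quaternion ℝ, i.re = 0 ∧ Quaternion.normSq i = 1 :=
  ⟨⟨0, 1, 0, 0⟩, rfl, (Quaternion.normSq_def' _).trans (by norm_num)⟩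

theorem isSliceAlgebra_quaternion : IsSliceAlgebra (Quaternion ℝ) := by
  obtain ⟨i, hre, hi⟩ := exists_quaternion_imaginary_unit
  refine isSliceAlgebra_of_realPart mul_add add_mul smul_mul_assoc (fun r x y => mul_smul_comm r x y)
    one_mul mul_one ⟨⟨fun x => x.re, Quaternion.re_add⟩, fun r x => Quaternion.re_smul x r⟩
    Quaternion.re_one quaternion_star_eq (fun x => ?_) (fun r y hy => ?_) quaternion_mem_unitSphere
    ⟨i, ?_⟩
  · rw [sq, ← Quaternion.normSq_eq_norm_mul_self]
    rfl
  · have hy' : y.re = 0 := hy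
    rw [sq ‖_‖, sq ‖_‖, ← Quaternion.normSq_eq_norm_mul_self, ← Quaternion.normSq_eq_norm_mul_self,
      Quaternion.normSq_def', Quaternion.normSq_def']
    simp [hy', Quaternion.re_one, Quaternion.imI_one, Quaternion.imJ_one, Quaternion.imK_one]
    ring
  · rw [quaternion_mem_unitSphere]
    refine ⟨hre, ?_⟩
    rw [← pow_eq_one_iff_of_nonneg (norm_nonneg _) two_ne_zero, sq,
      ← Quaternion.normSq_eq_norm_mul_self, hi]

/-! ### The octonions. -/

namespace Octonion

theorem ext {x y : Octonion} (h₁ : x.fst = y.fst) (h₂ : x.snd = y.snd) : x = y :=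
  congrArg (WithLp.toLp 2) (Prod.ext h₁ h₂ : WithLp.ofLp x = WithLp.ofLp y)

theorem fst_add (x y : Octonion) : (x + y).fst = x.fst + y.fst := rfl
theorem snd_add (x y : Octonion) : (x + y).snd = x.snd + y.snd := rfl
theorem snd_sub (x y : Octonion) : (x - y).snd = x.snd - y.snd := rfl
theorem fst_smul (r : ℝ) (x : Octonion) : (r • x).fst = r • x.fst := rfl
theorem snd_smul (r : ℝ) (x : Octonion) : (r • x).snd = r • x.snd := rfl
theorem fst_one : (1 : Octonion).fst = 1 := rfl
theorem snd_one : (1 : Octonion).snd = 0 := rfl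
theorem snd_star (x : Octonion) : (star x).snd = -x.snd := rfl
theorem fst_mul (x y : Octonion) : (x * y).fst = x.fst * y.fst - y.snd * star x.snd := rfl
theorem snd_mul (x y : Octonion) : (x * y).snd = star x.fst * y.snd + y.fst * x.snd := rfl

theorem norm_sq (x : Octonion) :
    ‖x‖ ^ 2 = Quaternion.normSq x.fst + Quaternion.normSq x.snd := by
  rw [Quaternion.normSq_eq_norm_mul_self, Quaternion.normSq_eq_norm_mul_self, ← sq, ← sq]
  exact WithLp.prod_norm_sq_eq_of_L2 (α := Quaternion ℝ) (β := Quaternion ℝ) x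

theorem mem_unitSphere (I : Octonion) :
    I ∈ unitSphere Octonion ↔ I.fst.re = 0 ∧ ‖I‖ = 1 := by
  have hn : ‖I‖ = 1 ↔ Quaternion.normSq I.fst + Quaternion.normSq I.snd = 1 := by
    rw [← norm_sq, pow_eq_one_iff_of_nonneg (norm_nonneg I) two_ne_zero]
  rw [hn]
  change I * I = -1 ↔ _
  have hext : I * I = -1 ↔ (I * I).fst = -1 ∧ (I * I).snd = 0 :=
    ⟨fun h => by rw [h]; exact ⟨rfl, neg_zero⟩, fun h => ext h.1 (h.2.trans neg_zero.symm)⟩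
  rw [hext, fst_mul, snd_mul]
  generalize I.fst = x
  generalize I.snd = y
  simp only [Quaternion.ext_iff, Quaternion.re_mul, Quaternion.imI_mul, Quaternion.imJ_mul,
    Quaternion.imK_mul, Quaternion.re_neg, Quaternion.imI_neg, Quaternion.imJ_neg,
    Quaternion.imK_neg, Quaternion.re_one, Quaternion.imI_one, Quaternion.imJ_one,
    Quaternion.imK_one, neg_zero, Quaternion.re_sub, Quaternion.imI_sub, Quaternion.imJ_sub,
    Quaternion.imK_sub, Quaternion.re_star, Quaternion.imI_star, Quaternion.imJ_star,
    Quaternion.imK_star, Quaternion.re_add, Quaternion.imI_add, Quaternion.imJ_add,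
    Quaternion.imK_add, Quaternion.re_zero, Quaternion.imI_zero, Quaternion.imJ_zero,
    Quaternion.imK_zero, Quaternion.normSq_def']
  constructor
  · rintro ⟨⟨h0, h1, h2, h3⟩, h4, h5, h6, h7⟩
    -- As for quaternions: the seven imaginary components of the square are `2 x.re` times those of
    -- `I`.
    have hre : x.re = 0 := by
      by_contra hne
      have e1 : x.imI = 0 := (mul_eq_zero.1 (by linarith : x.re * x.imI = 0)).resolve_left hne
      have e2 : x.imJ = 0 := (mul_eq_zero.1 (by linarith : x.re * x.imJ = 0)).resolve_left hne
      have e3 : x.imK = 0 := (mul_eq_zero.1 (by linarith : x.re * x.imK = 0)).resolve_left hne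
      have e4 : y.re = 0 := (mul_eq_zero.1 (by linarith : x.re * y.re = 0)).resolve_left hne
      have e5 : y.imI = 0 := (mul_eq_zero.1 (by linarith : x.re * y.imI = 0)).resolve_left hne
      have e6 : y.imJ = 0 := (mul_eq_zero.1 (by linarith : x.re * y.imJ = 0)).resolve_left hne
      have e7 : y.imK = 0 := (mul_eq_zero.1 (by linarith : x.re * y.imK = 0)).resolve_left hne
      rw [e1, e2, e3, e4, e5, e6, e7] at h0
      nlinarith [sq_nonneg x.re]
    refine ⟨hre, ?_⟩
    rw [hre] at h0 ⊢
    linarith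
  · rintro ⟨h0, h1⟩
    rw [h0] at h1 ⊢
    refine ⟨⟨by linarith, by ring, by ring, by ring⟩, by ring, by ring, by ring, by ring⟩

theorem isSliceAlgebra : IsSliceAlgebra Octonion := by
  obtain ⟨i, hre, hi⟩ := exists_quaternion_imaginary_unit
  refine isSliceAlgebra_of_realPart (fun x y z => ?_) (fun x y z => ?_) (fun r x y => ?_)
    (fun r x y => ?_) (fun x => ?_) (fun x => ?_)
    ⟨⟨fun x => x.fst.re, fun _ _ => rfl⟩, fun _ _ => rfl⟩ rfl (fun x => ?_) (fun x => rfl)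
    (fun r y hy => ?_) mem_unitSphere ⟨mk i 0, ?_⟩
  · apply ext <;> simp only [fst_mul, snd_mul, fst_add, snd_add, mul_add, add_mul] <;> abel
  · apply ext <;> simp only [fst_mul, snd_mul, fst_add, snd_add, mul_add, add_mul, star_add] <;> abel
  · apply ext <;> simp [fst_mul, snd_mul, fst_smul, snd_smul, smul_sub, smul_add]
  · apply ext <;> simp [fst_mul, snd_mul, fst_smul, snd_smul, smul_sub, smul_add]
  · apply ext <;> simp [fst_mul, snd_mul, fst_one, snd_one]
  · apply ext <;> simp [fst_mul, snd_mul, fst_one, snd_one]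
  · apply ext
    · exact quaternion_star_eq x.fst
    · simp [snd_star, snd_sub, snd_smul, snd_one]
  · have hy' : y.fst.re = 0 := hy
    rw [norm_sq, norm_sq, fst_add, snd_add, fst_smul, snd_smul, fst_one, snd_one,
      Quaternion.normSq_def', Quaternion.normSq_def' y.fst, smul_zero, zero_add]
    simp [hy', Quaternion.re_one, Quaternion.imI_one, Quaternion.imJ_one, Quaternion.imK_one]
    ring
  · rw [mem_unitSphere]
    refine ⟨hre, ?_⟩
    rw [← pow_eq_one_iff_of_nonneg (norm_nonneg _) two_ne_zero, norm_sq]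
    change Quaternion.normSq i + Quaternion.normSq 0 = 1
    rw [hi, map_zero, add_zero]

end Octonion

end SliceNash

theorem theorem6p10 :
    (∀ (Ω₀ : Set (Quaternion ℝ)) (f : Quaternion ℝ → Quaternion ℝ),
      SliceNash.IsDiscreteSingularSet Ω₀ → SliceNash.IsSliceNash Ω₀ᶜ f →
        ∃ (P Q : ℕ →₀ Quaternion ℝ) (r : Quaternion ℝ → Quaternion ℝ),
          SliceNash.IsSliceReciprocal Ω₀ᶜ (SliceNash.polynomialFun Q) r ∧
            SliceNash.IsSliceProduct Ω₀ᶜ r (SliceNash.polynomialFun P) f) ∧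
    (∀ (Ω₀ : Set SliceNash.Octonion) (f : SliceNash.Octonion → SliceNash.Octonion),
      SliceNash.IsDiscreteSingularSet Ω₀ → SliceNash.IsSliceNash Ω₀ᶜ f →
        ∃ (P Q : ℕ →₀ SliceNash.Octonion) (r : SliceNash.Octonion → SliceNash.Octonion),
          SliceNash.IsSliceReciprocal Ω₀ᶜ (SliceNash.polynomialFun Q) r ∧
            SliceNash.IsSliceProduct Ω₀ᶜ r (SliceNash.polynomialFun P) f) :=
  ⟨fun _ _ => SliceNash.isSliceAlgebra_quaternion.exists_quotient_of_isSliceNash,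
    fun _ _ => SliceNash.Octonion.isSliceAlgebra.exists_quotient_of_isSliceNash⟩
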